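/- **Setting.** Let $\mathcal V$ be a countably infinite set of variables and $\mathcal F$ a finite signature, partitioned into defined symbols $\mathcal D$ and constructors $\mathcal C$. *Values* are the terms built from variables and constructors. A *basic term* is a variable or a term $f(v_1,\dots,v_n)$ with $f\in\mathcal D$ and values $v_i$. The depth of a term is $\mathrm{dp}(x)=1$ for variables $x$ and $\mathrm{dp}(f(t_1,\dots,t_n))=1+\max(\{0\}\cup\{\mathrm{dp}(t_i)\})$. A (finite) TRS $\mathcal R$ is a finite set of rules $l\to r$ with $l$ not a variable and $\mathrm{Var}(r)\subseteq\mathrm{Var}(l)$; it is a *constructor TRS* if all left-hand sides are basic. The innermost rewrite relation $\xrightarrow{\mathsf i}_{\mathcal R}$ contracts only redexes all of whose arguments are normal forms, and the innermost derivation height of $s$ is $\mathrm{dh}_{\mathcal R}(s)=\max\{\ell\mid \exists t.\ s\xrightarrow{\mathsf i}{}^{\ell}_{\mathcal R}\,t\}$. A *precedence* is a preorder $\succsim$ on $\mathcal F$, with strict part $\succ$ and equivalence $\sim$; it is *admissible* if $f\sim g$ implies that $f,g$ are both defined or both constructors. A *safe mapping* declares some argument positions of each symbol *safe*, the others being *normal*;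 all argument positions of constructors are safe. We write $f(s_1,\dots,s_k;s_{k+1},\dots,s_{k+l})$, with normal arguments before and safe arguments after the semicolon. *Safe equivalence* $s\approx t$ holds if $s=t$, or $s=f(s_1,\dots,s_n)$, $t=g(t_1,\dots,t_n)$, $f\sim g$ and there is a permutation $\pi$ with $s_i\approx t_{\pi(i)}$ and ($i$ safe for $f$ iff $\pi(i)$ safe for $g$) for all $i$. For a symbol $f$ let $\mathcal T_{\prec f}$ be the set of terms all of whose function symbols $g$ satisfy $f\succ g$. The auxiliary order $\sqsupset$ is the least relation such that, for $s=f(s_1,\dots,s_k;s_{k+1},\dots,s_{k+l})$, $s\sqsupset t$ holds if 1. $s_i\sqsupset t$ or $s_i\approx t$ for some $i$, where $i$ is a normal position if $f\in\mathcal D$; or 2. $f\in\mathcal D$, $t=g(t_1,\dots,t_m;t_{m+1},\dots,t_{m+n})$, $f\succ g$, and $s\sqsupset t_j$ for all $j$. The order $>_{\mathsf{pop*ps}}$ of $\mathrm{POP}^*_{\mathrm{PS}}$, written $>$ here, is the least relation such that, for $s$ as above, $s>t$ holds if 1. $s_i>t$ or $s_i\approx t$ for some $i$; or 2. $f\in\mathcal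 D$, $t=g(t_1,\dots,t_m;t_{m+1},\dots,t_{m+n})$, $f\succ g$, $s\sqsupset t_j$ for all normal positions $j$ of $g$, $s>t_j$ for all safe positions $j$ of $g$, and $t_j\notin\mathcal T_{\prec f}$ for at most one safe position $j$ of $g$; or 3. $f\in\mathcal D$, $t=g(t_1,\dots,t_m;t_{m+1},\dots,t_{m+n})$, $f\sim g$, the multiset $\{\!\{s_1,\dots,s_k\}\!\}$ is greater than $\{\!\{t_1,\dots,t_m\}\!\}$ in the strict multiset extension of $>$ modulo $\approx$, and $s>t_j$ and $t_j\in\mathcal T_{\prec f}$ for all safe positions $j$ of $g$. Here the strict multiset extension compares multisets of $\approx$-classes: $M$ is greater than $N$ if $M=K\uplus X$ and $N=K\uplus Y$ with $X\neq\varnothing$, and every class in $Y$ is dominated by some class in $X$, where a class $A$ dominates a class $B$ if $a>b$ for some $a\in A$, $b\in B$. **Theorem.** Let $\mathcal R$ be a finite constructor TRS over $\mathcal F$ and $\mathcal V$. There is a polynomial $p$ with natural coefficients, depending only on $\mathcal R$ and $\mathcal F$, such that the following holds for every admissible precedence and every safe mapping for which $\mathcal R$ is compatible with the induced order, i.e.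 $l>_{\mathsf{pop*ps}}r$ for all rules $l\to r$ in $\mathcal R$: for every basic term $f(u_1,\dots,u_k;v_1,\dots,v_l)$ with $f\in\mathcal D$, $$\mathrm{dh}_{\mathcal R}\bigl(f(u_1,\dots,u_k;v_1,\dots,v_l)\bigr)\ \le\ p\Bigl(\max\bigl(\{0\}\cup\{\mathrm{dp}(u_1),\dots,\mathrm{dp}(u_k)\}\bigr)\Bigr);$$ in particular the left-hand side is finite. -/

import Mathlib

/-!
# Constructor term rewriting and the polynomial path order with parameter substitution
-/

namespace POP

/-! ## Signatures and terms -/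

/-- A signature: function symbols with arities, partitioned into defined symbols
and constructors (the symbols that are not defined). -/
structure Signature where
  /-- the function symbols -/
  Symb : Type*
  /-- the arity of a symbol -/
  ar : Symb → ℕ
  /-- the set of defined symbols -/
  Defined : Set Symb

/-- First-order terms over a signature `S` and variables `V`. -/
inductive Term (S : Signature) (V : Type*) where
  | var (x : V) : Term S V
  | app (f : S.Symb) (ts : Fin (S.ar f) → Term S V) : Term S V

namespace Term

variable {S : Signature} {V : Type*}

/-- The depth of a term: `1` for a variable and for a constant,
`1 + max_i depth t_i` for `f(t_1, …, t_n)`. -/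
def depth : Term S V → ℕ
  | var _ => 1
  | app _ ts => 1 + Finset.univ.sup fun i => depth (ts i)

/-- The variables of a term. -/
def vars : Term S V → Set V
  | var x => {x}
  | app _ ts => ⋃ i, vars (ts i)

/-- Application of a substitution. -/
def subst (σ : V → Term S V) : Term S V → Term S V
  | var x => σ x
  | app f ts => app f fun i => subst σ (ts i)

/-- Values: terms built from variables and constructors. -/
def IsValue : Term S V → Prop
  | var _ => True
  | app c ts => c ∉ S.Defined ∧ ∀ i, IsValue (ts i)

/-- Basic terms: variables, and terms `f(v_1, …, v_n)` with `f` defined and all `v_i` values. -/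
def IsBasic : Term S V → Prop
  | var _ => True
  | app f ts => f ∈ S.Defined ∧ ∀ i, IsValue (ts i)

end Term

/-! ## Rewriting -/

section Rewriting

variable {S : Signature} {V : Type*}

/-- Every pair `(l, r)` in `R` is a rewrite rule: `l` is not a variable and
all variables of `r` occur in `l`. -/
def IsTRS (R : Set (Term S V × Term S V)) : Prop :=
  ∀ l r, (l, r) ∈ R → (∀ x, l ≠ Term.var x) ∧ r.vars ⊆ l.vars

/-- A constructor TRS: a TRS all of whose left-hand sides are basic. -/
def IsConstructorTRS (R : Set (Term S V × Term S V)) : Prop :=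
  IsTRS R ∧ ∀ l r, (l, r) ∈ R → l.IsBasic

/-- The rewrite relation of `R`: the least relation that contains `R` and is closed under
substitutions and contexts. -/
inductive Rew (R : Set (Term S V × Term S V)) : Term S V → Term S V → Prop
  | root {l r : Term S V} (h : (l, r) ∈ R) (σ : V → Term S V) :
      Rew R (l.subst σ) (r.subst σ)
  | arg (f : S.Symb) (ts : Fin (S.ar f) → Term S V) (i : Fin (S.ar f)) {t' : Term S V}
      (h : Rew R (ts i) t') :
      Rew R (Term.app f ts) (Term.app f (Function.update ts i t'))

/-- Normal forms of `R`. -/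
def IsNF (R : Set (Term S V × Term S V)) (s : Term S V) : Prop :=
  ∀ t, ¬ Rew R s t

/-- The innermost rewrite relation of `R`: only redexes `lσ = f(s_1, …, s_n)` all of whose
arguments `s_i` are normal forms may be contracted. -/
inductive InnermostRew (R : Set (Term S V × Term S V)) : Term S V → Term S V → Prop
  | root {l r : Term S V} (h : (l, r) ∈ R) (σ : V → Term S V)
      (f : S.Symb) (ss : Fin (S.ar f) → Term S V) (hl : l.subst σ = Term.app f ss)
      (hnf : ∀ i, IsNF R (ss i)) :
      InnermostRew R (Term.app f ss) (r.subst σ)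
  | arg (f : S.Symb) (ts : Fin (S.ar f) → Term S V) (i : Fin (S.ar f)) {t' : Term S V}
      (h : InnermostRew R (ts i) t') :
      InnermostRew R (Term.app f ts) (Term.app f (Function.update ts i t'))

/-- The `n`-fold composition of a relation. -/
def Steps {α : Type*} (r : α → α → Prop) : ℕ → α → α → Prop
  | 0 => Eq
  | n + 1 => Relation.Comp r (Steps r n)

/-- The innermost derivation height of `s`: the maximal length of an innermost derivation
that starts in `s`; it is `⊤` if these lengths are unbounded. -/
noncomputable def innermostHeight (R : Set (Term S V × Term S V)) (s : Term S V) : ℕ∞ :=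
  ⨆ (n : ℕ) (_ : ∃ t, Steps (InnermostRew R) n s t), (n : ℕ∞)

end Rewriting

/-! ## Multiset extensions -/

/-- The multiset extension of a relation `r`: `N` arises from `M = K + X` by replacing the nonempty
submultiset `X` by a multiset `Y` each of whose elements is dominated by an element of `X`. -/
def MulExt {α : Type*} (r : α → α → Prop) (M N : Multiset α) : Prop :=
  ∃ K X Y : Multiset α, M = K + X ∧ N = K + Y ∧ X ≠ 0 ∧ ∀ y ∈ Y, ∃ x ∈ X, r x y

/-- The strict multiset extension of `gt` modulo an equivalence: the multiset extension, on
multisets of equivalence classes, of the relation induced by `gt` on equivalence classes. -/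
def StrictMulExt {α : Type*} (e : Setoid α) (gt : α → α → Prop) (M N : Multiset α) : Prop :=
  MulExt (Relation.Map gt (Quotient.mk e) (Quotient.mk e))
    (M.map (Quotient.mk e)) (N.map (Quotient.mk e))

theorem StrictMulExt.mono {α : Type*} {e : Setoid α} {r q : α → α → Prop} {M N : Multiset α}
    (hrq : ∀ a b, r a b → q a b) (h : StrictMulExt e r M N) : StrictMulExt e q M N := by
  obtain ⟨K, X, Y, hM, hN, hX, hY⟩ := h
  refine ⟨K, X, Y, hM, hN, hX, fun y hy => ?_⟩
  obtain ⟨x, hx, a, b, hab, ha, hb⟩ := hY y hy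
  exact ⟨x, hx, a, b, hrq a b hab, ha, hb⟩

/-! ## Precedences and safe mappings -/

/-- A (quasi-)precedence: a preorder on the function symbols. -/
structure Precedence (S : Signature) where
  /-- `ge f g` stands for `f ≿ g` -/
  ge : S.Symb → S.Symb → Prop
  refl : ∀ f, ge f f
  trans : ∀ f g h, ge f g → ge g h → ge f h

namespace Precedence

variable {S : Signature}

/-- The proper order `f ≻ g` induced by the precedence. -/
def gt (P : Precedence S) (f g : S.Symb) : Prop := P.ge f g ∧ ¬ P.ge g f

/-- The equivalence `f ∼ g` induced by the precedence. -/
def equiv (P : Precedence S) (f g : S.Symb) : Prop := P.ge f g ∧ P.ge g f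

/-- Admissibility: equivalent symbols are both defined or both constructors. -/
def Admissible (P : Precedence S) : Prop :=
  ∀ f g, P.equiv f g → (f ∈ S.Defined ↔ g ∈ S.Defined)

end Precedence

/-- A safe mapping: it declares some argument positions of each symbol safe, the others being
normal; all argument positions of constructors are safe. -/
structure SafeMapping (S : Signature) where
  /-- the safe argument positions of a symbol -/
  safe : (f : S.Symb) → Finset (Fin (S.ar f))
  safe_constructor : ∀ c, c ∉ S.Defined → safe c = Finset.univ

/-- The normal argument positions of a symbol. -/
def SafeMapping.normal {S : Signature} (sm : SafeMapping S) (f : S.Symb) :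
    Finset (Fin (S.ar f)) :=
  (sm.safe f)ᶜ

/-- The multiset of the arguments at normal positions of `f(s_1, …, s_n)`. -/
def SafeMapping.normalArgs {S : Signature} {V : Type*} (sm : SafeMapping S) (f : S.Symb)
    (ss : Fin (S.ar f) → Term S V) : Multiset (Term S V) :=
  (sm.normal f).val.map ss

/-- The maximal depth of the arguments at normal positions of `f(s_1, …, s_n)`
(`0` if there are none). -/
def SafeMapping.normalDepth {S : Signature} {V : Type*} (sm : SafeMapping S) (f : S.Symb)
    (ss : Fin (S.ar f) → Term S V) : ℕ :=
  (sm.normal f).sup fun i => (ss i).depth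

/-! ## The polynomial path order with parameter substitution -/

section Order

variable {S : Signature} {V : Type*}

/-- Every function symbol of the term is strictly below `f` in the precedence. -/
def Below (P : Precedence S) (f : S.Symb) : Term S V → Prop
  | Term.var _ => True
  | Term.app g ts => P.gt f g ∧ ∀ i, Below P f (ts i)

/-- Safe equivalence of terms: equality up to equivalent symbols and permutations of
arguments that respect the separation into safe and normal positions. -/
inductive SafeEquiv (P : Precedence S) (sm : SafeMapping S) : Term S V → Term S V → Prop
  | refl (t : Term S V) : SafeEquiv P sm t t
  | app (f g : S.Symb) (ss : Fin (S.ar f) → Term S V) (ts : Fin (S.ar g) → Term S V)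
      (hfg : P.equiv f g) (π : Fin (S.ar f) ≃ Fin (S.ar g))
      (hπ : ∀ i, i ∈ sm.safe f ↔ π i ∈ sm.safe g)
      (h : ∀ i, SafeEquiv P sm (ss i) (ts (π i))) :
      SafeEquiv P sm (Term.app f ss) (Term.app g ts)

theorem SafeEquiv.symm {P : Precedence S} {sm : SafeMapping S} {s t : Term S V}
    (h : SafeEquiv P sm s t) : SafeEquiv P sm t s := by
  induction h with
  | refl t => exact .refl t
  | app f g ss ts hfg π hπ h ih =>
    refine .app g f ts ss ⟨hfg.2, hfg.1⟩ π.symm (fun i => ?_) (fun i => ?_)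
    · simpa using (hπ (π.symm i)).symm
    · simpa using ih (π.symm i)

theorem SafeEquiv.trans {P : Precedence S} {sm : SafeMapping S} {s t u : Term S V}
    (h : SafeEquiv P sm s t) (h' : SafeEquiv P sm t u) : SafeEquiv P sm s u := by
  induction h generalizing u with
  | refl t => exact h'
  | app f g ss ts hfg π hπ h ih =>
    cases h' with
    | refl => exact .app f g ss ts hfg π hπ h
    | app _ k _ us hgk ρ hρ h2 =>
      exact .app f k ss us ⟨P.trans _ _ _ hfg.1 hgk.1, P.trans _ _ _ hgk.2 hfg.2⟩ (π.trans ρ)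
        (fun i => (hπ i).trans (hρ (π i))) (fun i => ih i (h2 (π i)))

/-- Safe equivalence as an equivalence relation on terms. -/
def safeSetoid (V : Type*) (P : Precedence S) (sm : SafeMapping S) : Setoid (Term S V) :=
  ⟨SafeEquiv P sm, ⟨.refl, .symm, .trans⟩⟩

/-- The auxiliary order. The first two constructors together are the clause
`s_i ⊒ t for some i`, where `⊒` is the union of the auxiliary order and safe equivalence, and
where `i` has to be a normal position if `f` is defined. -/
inductive AuxGt (P : Precedence S) (sm : SafeMapping S) : Term S V → Term S V → Prop
  | st_eq (f : S.Symb) (ss : Fin (S.ar f) → Term S V) (t : Term S V) (i : Fin (S.ar f))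
      (hi : f ∈ S.Defined → i ∈ sm.normal f) (h : SafeEquiv P sm (ss i) t) :
      AuxGt P sm (Term.app f ss) t
  | st_gt (f : S.Symb) (ss : Fin (S.ar f) → Term S V) (t : Term S V) (i : Fin (S.ar f))
      (hi : f ∈ S.Defined → i ∈ sm.normal f) (h : AuxGt P sm (ss i) t) :
      AuxGt P sm (Term.app f ss) t
  | ia (f g : S.Symb) (ss : Fin (S.ar f) → Term S V) (ts : Fin (S.ar g) → Term S V)
      (hf : f ∈ S.Defined) (hfg : P.gt f g)
      (h : ∀ j, AuxGt P sm (Term.app f ss) (ts j)) :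
      AuxGt P sm (Term.app f ss) (Term.app g ts)

/-- The polynomial path order with parameter substitution. The first two constructors together
are the clause `s_i ≽ t for some i`, where `≽` is the union of the order and safe equivalence.
In the last clause the normal arguments are compared by the strict multiset extension of the order
itself: as that extension is monotone, this is the same as to say that they are related by the
strict multiset extension of some relation `Q` contained in the order
(see `PopPSGt.app_equiv_iff`). -/
inductive PopPSGt (P : Precedence S) (sm : SafeMapping S) : Term S V → Term S V → Prop
  | st_eq (f : S.Symb) (ss : Fin (S.ar f) → Term S V) (t : Term S V) (i : Fin (S.ar f))
      (h : SafeEquiv P sm (ss i) t) :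
      PopPSGt P sm (Term.app f ss) t
  | st_gt (f : S.Symb) (ss : Fin (S.ar f) → Term S V) (t : Term S V) (i : Fin (S.ar f))
      (h : PopPSGt P sm (ss i) t) :
      PopPSGt P sm (Term.app f ss) t
  | ia (f g : S.Symb) (ss : Fin (S.ar f) → Term S V) (ts : Fin (S.ar g) → Term S V)
      (hf : f ∈ S.Defined) (hfg : P.gt f g)
      (hn : ∀ j ∈ sm.normal g, AuxGt P sm (Term.app f ss) (ts j))
      (hs : ∀ j ∈ sm.safe g, PopPSGt P sm (Term.app f ss) (ts j))
      (hone : {j | j ∈ sm.safe g ∧ ¬ Below P f (ts j)}.Subsingleton) :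
      PopPSGt P sm (Term.app f ss) (Term.app g ts)
  | ep (f g : S.Symb) (ss : Fin (S.ar f) → Term S V) (ts : Fin (S.ar g) → Term S V)
      (hf : f ∈ S.Defined) (hfg : P.equiv f g)
      (Q : Term S V → Term S V → Prop) (hQ : ∀ a b, Q a b → PopPSGt P sm a b)
      (hn : StrictMulExt (safeSetoid V P sm) Q (sm.normalArgs f ss) (sm.normalArgs g ts))
      (hs : ∀ j ∈ sm.safe g, PopPSGt P sm (Term.app f ss) (ts j))
      (hb : ∀ j ∈ sm.safe g, Below P f (ts j)) :
      PopPSGt P sm (Term.app f ss) (Term.app g ts)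

/-- The order satisfies its defining clauses in the case of equivalent root symbols. -/
theorem PopPSGt.app_equiv_iff {P : Precedence S} {sm : SafeMapping S} {f g : S.Symb}
    {ss : Fin (S.ar f) → Term S V} {ts : Fin (S.ar g) → Term S V} (hfg : P.equiv f g) :
    PopPSGt P sm (Term.app f ss) (Term.app g ts) ↔
      (∃ i, PopPSGt P sm (ss i) (Term.app g ts) ∨ SafeEquiv P sm (ss i) (Term.app g ts)) ∨
      (f ∈ S.Defined ∧
        StrictMulExt (safeSetoid V P sm) (PopPSGt P sm) (sm.normalArgs f ss) (sm.normalArgs g ts) ∧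
        ∀ j ∈ sm.safe g, PopPSGt P sm (Term.app f ss) (ts j) ∧ Below P f (ts j)) := by
  constructor
  · intro h
    cases h with
    | st_eq _ _ _ i h => exact Or.inl ⟨i, Or.inr h⟩
    | st_gt _ _ _ i h => exact Or.inl ⟨i, Or.inl h⟩
    | ia _ _ _ _ _ h _ _ _ => exact absurd hfg.2 h.2
    | ep _ _ _ _ hf _ Q hQ hn hs hb =>
      exact Or.inr ⟨hf, hn.mono hQ, fun j hj => ⟨hs j hj, hb j hj⟩⟩
  · rintro (⟨i, h | h⟩ | ⟨hf, hn, h⟩)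
    · exact .st_gt _ _ _ i h
    · exact .st_eq _ _ _ i h
    · exact .ep f g ss ts hf hfg _ (fun _ _ h => h) hn (fun j hj => (h j hj).1)
        (fun j hj => (h j hj).2)

/-- `R` is compatible with the order: all its rules are oriented from left to right. -/
def Compatible (P : Precedence S) (sm : SafeMapping S) (R : Set (Term S V × Term S V)) : Prop :=
  ∀ l r, (l, r) ∈ R → PopPSGt P sm l r

end Order

end POP

/-! The argument is the predicative analysis of recursion. Let `n` bound the depths of the normal
arguments of a call, all arguments being normal forms, and `d` those of the safe ones. The invariant
`CallBound` says that some polynomial `p` bounds the cost by `p(n)` and the depth of the result by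
`p(n) + d`. Safe depth enters additively only and never influences the cost, so such bounds compose
without leaving the polynomials. They are built by well-founded induction along the precedence.

For a defined `f`, suppose calls of equivalent symbols with smaller normal arguments cost at most
`E` and add at most `E` to the safe depth. Each right-hand side then costs at most `q(n) + E`, with
coefficient one at `E` (`PopPSGt.exists_bound`): at most one safe argument may contain symbols not
below `f`, terms in normal positions are controlled by the auxiliary order, which allows no
recursion (`AuxGt.exists_bound`), and the safe arguments of a recursive call contain only symbols
below `f` (`PopPSGt.exists_bound_of_below`). Hence recursion neither branches nor nests, and cost is
linear in the length of a chain of recursive calls.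

On values the order forces a strict decrease of depth, so along such a chain the multiset of normal
depths decreases in the Dershowitz-Manna order (`StrictMulExt.of_isValue`), while all entries stay
at most `n`. If `A` bounds the arities, there are at most `∑_{k ≤ A} (n+1)^k` such multisets, a
polynomial in `n` (`multisetRank_le`). This closes the induction in `exists_callBound_of_defined`.
Uniformity in the precedence and the safe mapping comes from there being finitely many of each. -/

namespace POP

open Polynomial

variable {S : Signature} {V : Type*}

/-! ## Constructor depth -/

open Classical in
/-- The depth of a term in which subterms with a defined root count as constants. -/
noncomputable def Term.cdepth : Term S V → ℕ
  | var _ => 1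
  | app f ts => if f ∈ S.Defined then 1 else 1 + Finset.univ.sup fun i => cdepth (ts i)

theorem Term.cdepth_defined {f : S.Symb} (hf : f ∈ S.Defined) (ts : Fin (S.ar f) → Term S V) :
    (Term.app f ts).cdepth = 1 := by
  simp [Term.cdepth, hf]

theorem Term.cdepth_constructor {f : S.Symb} (hf : f ∉ S.Defined)
    (ts : Fin (S.ar f) → Term S V) :
    (Term.app f ts).cdepth = 1 + Finset.univ.sup fun i => (ts i).cdepth := by
  simp [Term.cdepth, hf]

theorem Term.IsValue.cdepth_eq {t : Term S V} (ht : t.IsValue) : t.cdepth = t.depth := by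
  induction t with
  | var x => rfl
  | app f ts ih =>
    rw [Term.cdepth_constructor ht.1, Term.depth]
    simp only [fun i => ih i (ht.2 i)]

theorem Term.cdepth_arg_lt {f : S.Symb} (hf : f ∉ S.Defined) (ts : Fin (S.ar f) → Term S V)
    (i : Fin (S.ar f)) : (ts i).cdepth < (Term.app f ts).cdepth := by
  rw [Term.cdepth_constructor hf, Nat.lt_one_add_iff]
  exact Finset.le_sup (f := fun i => (ts i).cdepth) (Finset.mem_univ i)

/-! ## The orders on values -/

theorem SafeEquiv.isValue {P : Precedence S} {sm : SafeMapping S} (hP : P.Admissible)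
    {s t : Term S V} (h : SafeEquiv P sm s t) (hs : s.IsValue) : t.IsValue := by
  induction h with
  | refl t => exact hs
  | app f g ss ts hfg π hπ h ih =>
    refine ⟨fun hg => hs.1 ((hP f g hfg).2 hg), fun j => ?_⟩
    simpa using ih (π.symm j) (hs.2 _)

/-- Admissibility makes the two roots both defined, with depth 1, or both constructors, where
permuting the arguments does not change the maximum. -/
theorem SafeEquiv.cdepth_subst {P : Precedence S} {sm : SafeMapping S} (hP : P.Admissible)
    {s t : Term S V} (h : SafeEquiv P sm s t) (σ : V → Term S V) :
    (s.subst σ).cdepth = (t.subst σ).cdepth := by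
  induction h with
  | refl t => rfl
  | app f g ss ts hfg π hπ h ih =>
    simp only [Term.subst]
    by_cases hf : f ∈ S.Defined
    · rw [Term.cdepth_defined hf, Term.cdepth_defined ((hP f g hfg).1 hf)]
    · rw [Term.cdepth_constructor hf, Term.cdepth_constructor fun hg => hf ((hP f g hfg).2 hg)]
      rw [← Finset.univ_map_equiv_to_embedding π, Finset.sup_map]
      simp only [ih]
      rfl

theorem AuxGt.of_isValue {P : Precedence S} {sm : SafeMapping S} (hP : P.Admissible)
    {s t : Term S V} (h : AuxGt P sm s t) (hs : s.IsValue) :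
    t.IsValue ∧ ∀ σ, (t.subst σ).cdepth < (s.subst σ).cdepth := by
  induction h with
  | st_eq f ss t i hi h =>
    refine ⟨h.isValue hP (hs.2 i), fun σ => ?_⟩
    rw [← h.cdepth_subst hP σ]
    exact Term.cdepth_arg_lt hs.1 (fun i => (ss i).subst σ) i
  | st_gt f ss t i hi h ih =>
    exact ⟨(ih (hs.2 i)).1, fun σ =>
      ((ih (hs.2 i)).2 σ).trans (Term.cdepth_arg_lt hs.1 (fun i => (ss i).subst σ) i)⟩
  | ia f g ss ts hf hfg h ih => exact absurd hf hs.1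

/-- A value has no defined root, so only the two subterm clauses can apply, and each of them strips
a constructor. -/
theorem PopPSGt.of_isValue {P : Precedence S} {sm : SafeMapping S} (hP : P.Admissible)
    {s t : Term S V} (h : PopPSGt P sm s t) (hs : s.IsValue) :
    t.IsValue ∧ ∀ σ, (t.subst σ).cdepth < (s.subst σ).cdepth := by
  induction h with
  | st_eq f ss t i h =>
    refine ⟨h.isValue hP (hs.2 i), fun σ => ?_⟩
    rw [← h.cdepth_subst hP σ]
    exact Term.cdepth_arg_lt hs.1 (fun i => (ss i).subst σ) i
  | st_gt f ss t i h ih =>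
    exact ⟨(ih (hs.2 i)).1, fun σ =>
      ((ih (hs.2 i)).2 σ).trans (Term.cdepth_arg_lt hs.1 (fun i => (ss i).subst σ) i)⟩
  | ia f g ss ts hf => exact absurd hf hs.1
  | ep f g ss ts hf => exact absurd hf hs.1

/-- On multisets of values, the strict multiset extension of the order decreases the multiset of
depths, and it leads to values. -/
theorem StrictMulExt.of_isValue {P : Precedence S} {sm : SafeMapping S} (hP : P.Admissible)
    {M N : Multiset (Term S V)}
    (h : StrictMulExt (safeSetoid V P sm) (PopPSGt P sm) M N) (hM : ∀ s ∈ M, s.IsValue) :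
    (∀ t ∈ N, t.IsValue ∧ ∀ σ, ∃ s ∈ M, (t.subst σ).cdepth ≤ (s.subst σ).cdepth) ∧
    ∀ σ, Multiset.IsDershowitzMannaLT (N.map fun t => (t.subst σ).cdepth)
      (M.map fun t => (t.subst σ).cdepth) := by
  obtain ⟨K, X, Y, hMK, hNK, hX, hY⟩ := h
  -- Domination between classes is witnessed by some representatives `a` and `b`. It transfers to an
  -- actual member of `M` and to every representative of `y`, because being a value and the depth
  -- are invariant under safe equivalence.
  have hdom : ∀ y ∈ Y, ∃ s ∈ M, Quotient.mk (safeSetoid V P sm) s ∈ X ∧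
      ∀ t, Quotient.mk (safeSetoid V P sm) t = y →
        t.IsValue ∧ ∀ σ, (t.subst σ).cdepth < (s.subst σ).cdepth := by
    intro y hy
    obtain ⟨x, hx, a, b, hab, ha, hb⟩ := hY y hy
    have hxM : x ∈ M.map (Quotient.mk (safeSetoid V P sm)) := by
      rw [hMK]; exact Multiset.mem_add.2 (Or.inr hx)
    obtain ⟨s, hs, rfl⟩ := Multiset.mem_map.1 hxM
    have hsa : SafeEquiv P sm s a := Quotient.exact (s := safeSetoid V P sm) ha.symm
    have hab' := hab.of_isValue hP (hsa.isValue hP (hM s hs))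
    refine ⟨s, hs, hx, fun t ht => ?_⟩
    have hbt : SafeEquiv P sm b t := Quotient.exact (s := safeSetoid V P sm) (hb.trans ht.symm)
    refine ⟨hbt.isValue hP hab'.1, fun σ => ?_⟩
    rw [← hbt.cdepth_subst hP σ, hsa.cdepth_subst hP σ]
    exact hab'.2 σ
  constructor
  · intro t ht
    have htN : Quotient.mk (safeSetoid V P sm) t ∈ K + Y := by
      rw [← hNK]; exact Multiset.mem_map_of_mem _ ht
    rcases Multiset.mem_add.1 htN with htK | htY
    · have htM : Quotient.mk (safeSetoid V P sm) t ∈ M.map (Quotient.mk (safeSetoid V P sm)) := by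
        rw [hMK]; exact Multiset.mem_add.2 (Or.inl htK)
      obtain ⟨s, hs, hst⟩ := Multiset.mem_map.1 htM
      have hst' : SafeEquiv P sm s t := Quotient.exact (s := safeSetoid V P sm) hst
      exact ⟨hst'.isValue hP (hM s hs), fun σ => ⟨s, hs, (hst'.cdepth_subst hP σ).ge⟩⟩
    · obtain ⟨s, hs, -, h⟩ := hdom _ htY
      exact ⟨(h t rfl).1, fun σ => ⟨s, hs, ((h t rfl).2 σ).le⟩⟩
  · intro σ
    -- Depth is a function on classes, so the decomposition of the multisets of classes maps to one
    -- of the multisets of depths.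
    let F : Quotient (safeSetoid V P sm) → ℕ :=
      Quotient.lift (fun t => (t.subst σ).cdepth) fun a b hab => SafeEquiv.cdepth_subst hP hab σ
    refine ⟨K.map F, Y.map F, X.map F, by simpa using hX, ?_, ?_, ?_⟩
    · rw [← Multiset.map_add, ← hNK, Multiset.map_map]; rfl
    · rw [← Multiset.map_add, ← hMK, Multiset.map_map]; rfl
    · intro y hy
      obtain ⟨z, hz, rfl⟩ := Multiset.mem_map.1 hy
      obtain ⟨s, hs, hsX, h⟩ := hdom z hz
      refine ⟨F (Quotient.mk _ s), Multiset.mem_map_of_mem _ hsX, ?_⟩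
      induction z using Quotient.inductionOn with
      | h t => exact (h t rfl).2 σ

/-! ## Normal forms and innermost derivations -/

section Rewriting

variable {R : Set (Term S V × Term S V)}

theorem InnermostRew.rew {s t : Term S V} (h : InnermostRew R s t) : Rew R s t := by
  induction h with
  | root h σ f ss hl hnf => exact hl ▸ Rew.root h σ
  | arg f ts i h ih => exact .arg f ts i ih

theorem IsNF.arg {f : S.Symb} {ts : Fin (S.ar f) → Term S V} (h : IsNF R (Term.app f ts))
    (i : Fin (S.ar f)) : IsNF R (ts i) :=
  fun _ ht => h _ (.arg f ts i ht)

theorem IsNF.of_mem_vars {σ : V → Term S V} {t : Term S V} (h : IsNF R (t.subst σ)) {x : V}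
    (hx : x ∈ t.vars) : IsNF R (σ x) := by
  induction t with
  | var y => cases hx; exact h
  | app f ts ih =>
    obtain ⟨i, hi⟩ := Set.mem_iUnion.1 hx
    exact ih i (IsNF.arg (ts := fun i => (ts i).subst σ) h i) hi

theorem IsConstructorTRS.exists_app (hR : IsConstructorTRS R) {l r : Term S V}
    (h : (l, r) ∈ R) : ∃ f ls, l = Term.app f ls ∧ f ∈ S.Defined ∧ ∀ i, (ls i).IsValue := by
  have hb := hR.2 l r h
  cases l with
  | var x => exact absurd rfl ((hR.1 _ r h).1 x)
  | app f ls => exact ⟨f, ls, rfl, hb.1, hb.2⟩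

/-- Left-hand sides have defined roots, so no redex can arise at a constructor. -/
theorem IsConstructorTRS.isNF_constructor (hR : IsConstructorTRS R) {f : S.Symb}
    (hf : f ∉ S.Defined) {ts : Fin (S.ar f) → Term S V} (h : ∀ i, IsNF R (ts i)) :
    IsNF R (Term.app f ts) := by
  intro t ht
  generalize hs : Term.app f ts = s at ht
  cases ht with
  | root hlr σ =>
    obtain ⟨g, ls, rfl, hg, -⟩ := hR.exists_app hlr
    cases hs
    exact hf hg
  | arg g us i h' =>
    cases hs
    exact h i _ h'

theorem IsConstructorTRS.isNF_value (hR : IsConstructorTRS R) {t : Term S V} (ht : t.IsValue)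
    {σ : V → Term S V} (hσ : ∀ x ∈ t.vars, IsNF R (σ x)) : IsNF R (t.subst σ) := by
  induction t with
  | var x => exact hσ x rfl
  | app f ts ih =>
    exact hR.isNF_constructor ht.1 fun i =>
      ih i (ht.2 i) fun x hx => hσ x (Set.mem_iUnion.2 ⟨i, hx⟩)

theorem IsConstructorTRS.isNF_of_isValue (hR : IsConstructorTRS R) {t : Term S V}
    (ht : t.IsValue) : IsNF R t := by
  induction t with
  | var x =>
    intro t ht
    generalize hs : Term.var x = s at ht
    cases ht with
    | root hlr σ =>
      obtain ⟨g, ls, rfl, -, -⟩ := hR.exists_app hlr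
      cases hs
    | arg g us i h' => cases hs
  | app f ts ih => exact hR.isNF_constructor ht.1 fun i => ih i (ht.2 i)

/-- An innermost derivation from `f(s_1, …, s_n)` first rewrites the arguments; it rewrites at the
root only once these are normal forms. -/
theorem Steps.innermost_app {f : S.Symb} {n : ℕ} {ss : Fin (S.ar f) → Term S V} {t : Term S V}
    (h : Steps (InnermostRew R) n (Term.app f ss) t) :
    ∃ (m : Fin (S.ar f) → ℕ) (w : Fin (S.ar f) → Term S V),
      (∀ i, Steps (InnermostRew R) (m i) (ss i) (w i)) ∧
      ((t = Term.app f w ∧ n = ∑ i, m i) ∨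
        ((∀ i, IsNF R (w i)) ∧ ∃ k, n = ∑ i, m i + k ∧
          Steps (InnermostRew R) k (Term.app f w) t)) := by
  induction n generalizing ss with
  | zero =>
    exact ⟨fun _ => 0, ss, fun _ => rfl, Or.inl ⟨h.symm, by simp⟩⟩
  | succ n ih =>
    obtain ⟨u, hu, hut⟩ := h
    have hu' := hu
    generalize hs : Term.app f ss = s at hu
    cases hu with
    | root hlr σ g us hl hnf =>
      cases hs
      exact ⟨fun _ => 0, ss, fun _ => rfl, Or.inr ⟨hnf, n + 1, by simp, _, hu', hut⟩⟩
    | arg g us i h' =>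
      cases hs
      obtain ⟨m, w, hm, hor⟩ := ih hut
      -- The first step takes place in argument `i` and raises only that argument's count.
      have hsum : ∑ j, (m + Pi.single i 1 : Fin (S.ar f) → ℕ) j = ∑ j, m j + 1 := by
        simp [Finset.sum_add_distrib]
      refine ⟨m + (Pi.single i 1 : Fin (S.ar f) → ℕ), w, fun j => ?_, ?_⟩
      · have hj := hm j
        by_cases hji : j = i
        · subst hji
          rw [Function.update_self] at hj
          simp only [Pi.add_apply, Pi.single_eq_same]
          exact ⟨_, h', hj⟩
        · rw [Function.update_of_ne hji] at hj
          simpa [hji] using hj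
      · rcases hor with ⟨h1, h2⟩ | ⟨h1, k, h2, h3⟩
        · exact Or.inl ⟨h1, by rw [hsum, h2]⟩
        · exact Or.inr ⟨h1, k, by rw [hsum, h2]; ring, h3⟩

/-! ## Cost-bounded evaluation -/

/-- Innermost derivations from `s` have length at most `c`, and the normal forms reached by them
satisfy `Φ`. -/
def Evals (R : Set (Term S V × Term S V)) (s : Term S V) (c : ℕ) (Φ : Term S V → Prop) : Prop :=
  ∀ n t, Steps (InnermostRew R) n s t → n ≤ c ∧ (IsNF R t → Φ t)

theorem Evals.mono {s : Term S V} {c c' : ℕ} {Φ Ψ : Term S V → Prop} (h : Evals R s c Φ)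
    (hc : c ≤ c') (hΦ : ∀ t, Φ t → Ψ t) : Evals R s c' Ψ :=
  fun n t hn => ⟨(h n t hn).1.trans hc, fun ht => hΦ t ((h n t hn).2 ht)⟩

theorem IsNF.evals {s : Term S V} (h : IsNF R s) : Evals R s 0 (· = s) := by
  intro n t hn
  cases n with
  | zero => exact ⟨le_rfl, fun _ => hn.symm⟩
  | succ n =>
    obtain ⟨u, hu, -⟩ := hn
    exact absurd hu.rew (h u)

/-- The costs of the arguments add up, and the root contributes only after all of them are normal
forms. Termination of the arguments is not presupposed: their derivations are bounded whether or not
they end in a normal form. -/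
theorem Evals.app {f : S.Symb} {ss : Fin (S.ar f) → Term S V} {c : Fin (S.ar f) → ℕ}
    {Φ : Fin (S.ar f) → Term S V → Prop} {c' : ℕ} {Ψ : Term S V → Prop}
    (h : ∀ i, Evals R (ss i) (c i) (Φ i))
    (h' : ∀ w, (∀ i, IsNF R (w i)) → (∀ i, Φ i (w i)) → Evals R (Term.app f w) c' Ψ) :
    Evals R (Term.app f ss) (∑ i, c i + c') Ψ := by
  intro n t hn
  obtain ⟨m, w, hm, ⟨rfl, rfl⟩ | ⟨hw, k, rfl, hk⟩⟩ := hn.innermost_app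
  · have hle : ∑ i, m i ≤ ∑ i, c i := Finset.sum_le_sum fun i _ => (h i _ _ (hm i)).1
    refine ⟨hle.trans (Nat.le_add_right _ _), fun ht => ?_⟩
    -- No root phase occurred; the postcondition is read off the empty derivation from `f(w)`.
    exact (h' w ht.arg (fun i => (h i _ _ (hm i)).2 (ht.arg i)) 0 _ rfl).2 ht
  · have hle : ∑ i, m i ≤ ∑ i, c i := Finset.sum_le_sum fun i _ => (h i _ _ (hm i)).1
    have hk' := h' w hw (fun i => (h i _ _ (hm i)).2 (hw i)) k t hk
    exact ⟨add_le_add hle hk'.1, hk'.2⟩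

/-- Evaluation of a call all of whose arguments are normal forms. -/
theorem IsConstructorTRS.evals_call (hR : IsConstructorTRS R) {f : S.Symb}
    {w : Fin (S.ar f) → Term S V} (hw : ∀ i, IsNF R (w i)) {c : ℕ} {Φ : Term S V → Prop} (h0 : Φ (Term.app f w))
    (h : ∀ ls r σ, (Term.app f ls, r) ∈ R → (∀ i, (ls i).IsValue) → (∀ i, w i = (ls i).subst σ) →
      (∀ x ∈ r.vars, IsNF R (σ x)) → Evals R (r.subst σ) c Φ) :
    Evals R (Term.app f w) (c + 1) Φ := by
  intro n t hn
  cases n with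
  | zero => cases hn; exact ⟨Nat.zero_le _, fun _ => h0⟩
  | succ n =>
    obtain ⟨u, hu, hut⟩ := hn
    generalize hs : Term.app f w = s at hu
    cases hu with
    | @root l r hlr σ g us hl hnf =>
      obtain ⟨k, ls, rfl, hk, hls⟩ := hR.exists_app hlr
      cases hs
      simp only [Term.subst] at hl
      cases hl
      have := h ls r σ hlr hls (fun _ => rfl) (fun x hx => ?_) n t hut
      · exact ⟨Nat.succ_le_succ this.1, this.2⟩
      · obtain ⟨i, hi⟩ := Set.mem_iUnion.1 ((hR.1 _ _ hlr).2 hx)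
        exact (hw i).of_mem_vars hi
    | arg g us i h' =>
      cases hs
      exact absurd h'.rew (hw i _)

/-- The polynomial `p`, evaluated at the depth of the normal arguments, bounds the innermost
derivation height of calls of `f` and the growth of depth over the safe arguments. -/
def CallBound (R : Set (Term S V × Term S V)) (sm : SafeMapping S) (f : S.Symb) (p : ℕ[X]) :
    Prop :=
  ∀ (w : Fin (S.ar f) → Term S V) (n d : ℕ), (∀ i, IsNF R (w i)) →
    (∀ i ∈ sm.normal f, (w i).cdepth ≤ n) → (∀ i ∈ sm.safe f, (w i).cdepth ≤ d) →
    Evals R (Term.app f w) (p.eval n) fun t => t.cdepth ≤ p.eval n + d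

theorem CallBound.mono {sm : SafeMapping S} {f : S.Symb} {p q : ℕ[X]} (h : CallBound R sm f p)
    (hpq : ∀ n, p.eval n ≤ q.eval n) : CallBound R sm f q :=
  fun w n d hw hn hs => (h w n d hw hn hs).mono (hpq n) fun _ ht =>
    ht.trans (Nat.add_le_add_right (hpq n) d)

/-- All positions of a constructor are safe, and it adds a single layer to them; this is the
constant 1. -/
theorem IsConstructorTRS.callBound_constructor (hR : IsConstructorTRS R) {sm : SafeMapping S}
    {f : S.Symb} (hf : f ∉ S.Defined) : CallBound R sm f 1 := by
  intro w n d hw _ hs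
  refine (hR.isNF_constructor hf hw).evals.mono (Nat.zero_le _) ?_
  rintro _ rfl
  rw [Term.cdepth_constructor hf, Polynomial.eval_one]
  refine Nat.add_le_add_left (Finset.sup_le fun i _ => hs i ?_) 1
  rw [sm.safe_constructor f hf]
  exact Finset.mem_univ i

theorem SafeMapping.mem_normal_or_mem_safe (sm : SafeMapping S) {f : S.Symb}
    (i : Fin (S.ar f)) : i ∈ sm.normal f ∨ i ∈ sm.safe f := by
  unfold SafeMapping.normal
  by_cases h : i ∈ sm.safe f <;> simp [h]

theorem SafeMapping.notMem_safe (sm : SafeMapping S) {f : S.Symb} {i : Fin (S.ar f)}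
    (h : i ∈ sm.normal f) : i ∉ sm.safe f :=
  Finset.mem_compl.1 h

theorem CallBound.evals_app {sm : SafeMapping S} {f : S.Symb} {p : ℕ[X]}
    (h : CallBound R sm f p) {ss : Fin (S.ar f) → Term S V} {c D : Fin (S.ar f) → ℕ} {n d : ℕ}
    (hs : ∀ i, Evals R (ss i) (c i) fun t => t.cdepth ≤ D i)
    (hn : ∀ i ∈ sm.normal f, D i ≤ n) (hd : ∀ i ∈ sm.safe f, D i ≤ d) :
    Evals R (Term.app f ss) (∑ i, c i + p.eval n) fun t => t.cdepth ≤ p.eval n + d :=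
  Evals.app hs fun w hw hD => h w n d hw (fun i hi => (hD i).trans (hn i hi))
    fun i hi => (hD i).trans (hd i hi)

/-! ## Evaluation of right-hand sides -/

section Bounds

variable {P : Precedence S} {sm : SafeMapping S}

theorem eval_le_eval_sum {ι : Type*} [Fintype ι] (p : ι → ℕ[X]) (i : ι) (n : ℕ) :
    (p i).eval n ≤ (∑ j, p j).eval n := by
  rw [Polynomial.eval_finsetSum]
  exact Finset.single_le_sum (f := fun j => (p j).eval n) (fun _ _ => Nat.zero_le _)
    (Finset.mem_univ i)

theorem IsConstructorTRS.evals_value (hR : IsConstructorTRS R) {t : Term S V} (ht : t.IsValue)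
    {σ : V → Term S V} (hσ : ∀ x ∈ t.vars, IsNF R (σ x)) {c D : ℕ}
    (hD : (t.subst σ).cdepth ≤ D) : Evals R (t.subst σ) c fun t => t.cdepth ≤ D := by
  refine (hR.isNF_value ht hσ).evals.mono (Nat.zero_le _) ?_
  rintro _ rfl
  exact hD

/-- The auxiliary order reaches into a defined `f` only through normal positions and otherwise uses
symbols below `f`. Neither the safe depth nor a recursive call can therefore occur in the bound. -/
theorem AuxGt.exists_bound (hR : IsConstructorTRS R) (hP : P.Admissible) {f : S.Symb}
    (hf : f ∈ S.Defined) {p : ℕ[X]} (hp : ∀ g, P.gt f g → CallBound R sm g p)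
    {ls : Fin (S.ar f) → Term S V} (hls : ∀ i, (ls i).IsValue) {t : Term S V}
    (h : AuxGt P sm (Term.app f ls) t) :
    ∃ q : ℕ[X], ∀ (σ : V → Term S V) (n : ℕ), (∀ x ∈ t.vars, IsNF R (σ x)) →
      (∀ i ∈ sm.normal f, ((ls i).subst σ).cdepth ≤ n) →
      Evals R (t.subst σ) (q.eval n) fun u => u.cdepth ≤ q.eval n := by
  generalize hs : Term.app f ls = s at h
  induction h with
  | st_eq _ _ t i hi h =>
    cases hs
    refine ⟨X, fun σ n hσ hn => hR.evals_value (h.isValue hP (hls i)) hσ ?_⟩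
    rw [← h.cdepth_subst hP σ, Polynomial.eval_X]
    exact hn i (hi hf)
  | st_gt _ _ t i hi h =>
    cases hs
    have h' := h.of_isValue hP (hls i)
    refine ⟨X, fun σ n hσ hn => hR.evals_value h'.1 hσ ?_⟩
    rw [Polynomial.eval_X]
    exact (h'.2 σ).le.trans (hn i (hi hf))
  | ia _ g _ ts _ hfg _ ih =>
    cases hs
    choose q hq using fun j => ih j rfl
    -- The sum bounds the total cost of the arguments and also each of their depths, so that `p` is
    -- applied to it for the call of `g`.
    refine ⟨∑ j, q j + p.comp (∑ j, q j), fun σ n hσ hn => ?_⟩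
    have hle := fun j => eval_le_eval_sum q j n
    refine ((hp g hfg).evals_app (n := (∑ j, q j).eval n) (d := (∑ j, q j).eval n)
      (fun j => hq j σ n (fun x hx => hσ x (Set.mem_iUnion.2 ⟨j, hx⟩)) hn)
      (fun j _ => hle j) (fun j _ => hle j)).mono ?_ fun u hu => ?_
    · rw [Polynomial.eval_add, Polynomial.eval_comp, Polynomial.eval_finsetSum]
    · rw [Polynomial.eval_add, Polynomial.eval_comp]
      omega

theorem cdepth_le_add_of_forall {f : S.Symb} {w : Fin (S.ar f) → Term S V} {n d : ℕ}
    (hn : ∀ i ∈ sm.normal f, (w i).cdepth ≤ n) (hd : ∀ i ∈ sm.safe f, (w i).cdepth ≤ d)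
    (i : Fin (S.ar f)) : (w i).cdepth ≤ n + d := by
  rcases sm.mem_normal_or_mem_safe i with hi | hi
  · exact (hn i hi).trans (Nat.le_add_right _ _)
  · exact (hd i hi).trans (Nat.le_add_left _ _)

/-- A term with all symbols below `f` excludes the clause for equivalent roots, so no recursive call
has to be paid for. -/
theorem PopPSGt.exists_bound_of_below (hR : IsConstructorTRS R) (hP : P.Admissible) {f : S.Symb}
    (hf : f ∈ S.Defined) {p : ℕ[X]} (hp : ∀ g, P.gt f g → CallBound R sm g p)
    {ls : Fin (S.ar f) → Term S V} (hls : ∀ i, (ls i).IsValue) {t : Term S V}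
    (h : PopPSGt P sm (Term.app f ls) t) (hb : Below P f t) :
    ∃ q : ℕ[X], ∀ (σ : V → Term S V) (n d : ℕ), (∀ x ∈ t.vars, IsNF R (σ x)) →
      (∀ i ∈ sm.normal f, ((ls i).subst σ).cdepth ≤ n) →
      (∀ i ∈ sm.safe f, ((ls i).subst σ).cdepth ≤ d) →
      Evals R (t.subst σ) (q.eval n) fun u => u.cdepth ≤ q.eval n + d := by
  generalize hs : Term.app f ls = s at h
  induction h with
  | st_eq _ _ t i h =>
    cases hs
    refine ⟨X, fun σ n d hσ hn hd => hR.evals_value (h.isValue hP (hls i)) hσ ?_⟩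
    rw [← h.cdepth_subst hP σ, Polynomial.eval_X]
    exact cdepth_le_add_of_forall hn hd i
  | st_gt _ _ t i h =>
    cases hs
    have h' := h.of_isValue hP (hls i)
    refine ⟨X, fun σ n d hσ hn hd => hR.evals_value h'.1 hσ ?_⟩
    rw [Polynomial.eval_X]
    exact (h'.2 σ).le.trans (cdepth_le_add_of_forall hn hd i)
  | ia _ g _ ts _ hfg hn' hs' hone ih =>
    cases hs
    have key : ∀ j, ∃ q : ℕ[X], ∀ (σ : V → Term S V) (n d : ℕ),
        (∀ x ∈ (ts j).vars, IsNF R (σ x)) →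
        (∀ i ∈ sm.normal f, ((ls i).subst σ).cdepth ≤ n) →
        (∀ i ∈ sm.safe f, ((ls i).subst σ).cdepth ≤ d) →
        Evals R ((ts j).subst σ) (q.eval n)
          fun u => u.cdepth ≤ q.eval n + if j ∈ sm.safe g then d else 0 := by
      intro j
      by_cases hj : j ∈ sm.safe g
      · simpa only [hj, if_true] using ih j hj (hb.2 j) rfl
      · obtain ⟨q, hq⟩ := AuxGt.exists_bound hR hP hf hp hls
          (hn' j ((sm.mem_normal_or_mem_safe j).resolve_right hj))
        refine ⟨q, fun σ n d hσ hn _ => ?_⟩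
        simpa only [hj, if_false, add_zero] using hq σ n hσ hn
    choose q hq using key
    -- Only safe arguments have results whose depth depends on `d`; the argument of `p` is thus free
    -- of `d`.
    refine ⟨∑ j, q j + p.comp (∑ j, q j), fun σ n d hσ hn hd => ?_⟩
    have hle := fun j => eval_le_eval_sum q j n
    refine ((hp g hfg).evals_app (n := (∑ j, q j).eval n) (d := (∑ j, q j).eval n + d)
      (fun j => hq j σ n d (fun x hx => hσ x (Set.mem_iUnion.2 ⟨j, hx⟩)) hn hd)
      (fun j hj => ?_) (fun j hj => ?_)).mono ?_ fun u hu => ?_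
    · simpa [sm.notMem_safe hj] using hle j
    · simpa [hj] using hle j
    · rw [Polynomial.eval_add, Polynomial.eval_comp, Polynomial.eval_finsetSum]
    · rw [Polynomial.eval_add, Polynomial.eval_comp]
      omega
  | ep _ g _ ts _ hfg => cases hs; exact absurd hfg.2 hb.1.2

/-- The depths of the normal arguments of `f(w_1, …, w_n)`. -/
noncomputable def normalDepths (sm : SafeMapping S) (f : S.Symb)
    (w : Fin (S.ar f) → Term S V) : Multiset ℕ :=
  (sm.normal f).val.map fun i => (w i).cdepth

/-- Calls of symbols equivalent to `f` with normal arguments of depth at most `n` that are smaller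
than `M` in the multiset order cost at most `E` and increase the safe depth by at most `E`. -/
def SmallerCallBound (R : Set (Term S V × Term S V)) (P : Precedence S) (sm : SafeMapping S)
    (f : S.Symb) (n : ℕ) (M : Multiset ℕ) (E : ℕ) : Prop :=
  ∀ (g : S.Symb) (w : Fin (S.ar g) → Term S V) (d : ℕ), P.equiv f g → (∀ i, IsNF R (w i)) →
    (∀ i ∈ sm.normal g, (w i).cdepth ≤ n) →
    Multiset.IsDershowitzMannaLT (normalDepths sm g w) M →
    (∀ i ∈ sm.safe g, (w i).cdepth ≤ d) →
    Evals R (Term.app g w) E fun t => t.cdepth ≤ E + d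

theorem PopPSGt.exists_bound (hR : IsConstructorTRS R) (hP : P.Admissible) {f : S.Symb}
    (hf : f ∈ S.Defined) {p : ℕ[X]} (hp : ∀ g, P.gt f g → CallBound R sm g p)
    {ls : Fin (S.ar f) → Term S V} (hls : ∀ i, (ls i).IsValue) {t : Term S V}
    (h : PopPSGt P sm (Term.app f ls) t) :
    ∃ q : ℕ[X], ∀ (σ : V → Term S V) (n d E : ℕ), (∀ x ∈ t.vars, IsNF R (σ x)) →
      (∀ i ∈ sm.normal f, ((ls i).subst σ).cdepth ≤ n) →
      (∀ i ∈ sm.safe f, ((ls i).subst σ).cdepth ≤ d) →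
      SmallerCallBound R P sm f n (normalDepths sm f fun i => (ls i).subst σ) E →
      Evals R (t.subst σ) (q.eval n + E) fun u => u.cdepth ≤ q.eval n + E + d := by
  classical
  generalize hs : Term.app f ls = s at h
  induction h with
  | st_eq _ _ t i h =>
    cases hs
    refine ⟨X, fun σ n d E hσ hn hd _ => hR.evals_value (h.isValue hP (hls i)) hσ ?_⟩
    rw [← h.cdepth_subst hP σ, Polynomial.eval_X]
    have := cdepth_le_add_of_forall hn hd i
    omega
  | st_gt _ _ t i h =>
    cases hs
    have h' := h.of_isValue hP (hls i)
    refine ⟨X, fun σ n d E hσ hn hd _ => hR.evals_value h'.1 hσ ?_⟩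
    rw [Polynomial.eval_X]
    have := cdepth_le_add_of_forall hn hd i
    have := h'.2 σ
    omega
  | ia _ g _ ts _ hfg hn' hs' hone ih =>
    cases hs
    -- The cost `E` is charged only to a safe argument that is not below `f`. In the depth it may be
    -- allowed at every safe position, since depths combine by maximum and not by sum.
    have key : ∀ j, ∃ q : ℕ[X], ∀ (σ : V → Term S V) (n d E : ℕ),
        (∀ x ∈ (ts j).vars, IsNF R (σ x)) →
        (∀ i ∈ sm.normal f, ((ls i).subst σ).cdepth ≤ n) →
        (∀ i ∈ sm.safe f, ((ls i).subst σ).cdepth ≤ d) →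
        SmallerCallBound R P sm f n (normalDepths sm f fun i => (ls i).subst σ) E →
        Evals R ((ts j).subst σ)
          (q.eval n + if j ∈ sm.safe g ∧ ¬ Below P f (ts j) then E else 0)
          fun u => u.cdepth ≤ q.eval n + if j ∈ sm.safe g then E + d else 0 := by
      intro j
      by_cases hj : j ∈ sm.safe g
      · by_cases hb : Below P f (ts j)
        · obtain ⟨q, hq⟩ := (hs' j hj).exists_bound_of_below hR hP hf hp hls hb
          refine ⟨q, fun σ n d E hσ hn hd _ => (hq σ n d hσ hn hd).mono (by omega) ?_⟩
          intro u hu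
          rw [if_pos hj]
          omega
        · obtain ⟨q, hq⟩ := ih j hj rfl
          refine ⟨q, fun σ n d E hσ hn hd hE => (hq σ n d E hσ hn hd hE).mono ?_ ?_⟩
          · rw [if_pos ⟨hj, hb⟩]
          · intro u hu
            rw [if_pos hj]
            omega
      · obtain ⟨q, hq⟩ := AuxGt.exists_bound hR hP hf hp hls
          (hn' j ((sm.mem_normal_or_mem_safe j).resolve_right hj))
        refine ⟨q, fun σ n d E hσ hn _ _ => (hq σ n hσ hn).mono (by omega) fun u hu => ?_⟩
        rw [if_neg hj]
        exact hu
    choose q hq using key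
    refine ⟨∑ j, q j + p.comp (∑ j, q j), fun σ n d E hσ hn hd hE => ?_⟩
    have hle := fun j => eval_le_eval_sum q j n
    -- By `hone` at most one summand is nonzero, which keeps the coefficient of `E` at one.
    have hsum : (∑ j, if j ∈ sm.safe g ∧ ¬ Below P f (ts j) then E else 0) ≤ E := by
      rw [← Finset.sum_filter, Finset.sum_const, smul_eq_mul]
      refine (Nat.mul_le_mul_right E (Finset.card_le_one.2 fun a ha b hb => ?_)).trans_eq (one_mul E)
      exact hone (Finset.mem_filter.1 ha).2 (Finset.mem_filter.1 hb).2
    refine ((hp g hfg).evals_app (n := (∑ j, q j).eval n) (d := (∑ j, q j).eval n + (E + d))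
      (fun j => hq j σ n d E (fun x hx => hσ x (Set.mem_iUnion.2 ⟨j, hx⟩)) hn hd hE)
      (fun j hj => ?_) (fun j hj => ?_)).mono ?_ fun u hu => ?_
    · simpa [sm.notMem_safe hj] using hle j
    · simpa [hj] using hle j
    · rw [Finset.sum_add_distrib, Polynomial.eval_add, Polynomial.eval_comp,
        ← Polynomial.eval_finsetSum]
      omega
    · rw [Polynomial.eval_add, Polynomial.eval_comp]
      omega
  | ep _ g _ ts _ hfg Q hQ hn' hs' hb ih =>
    cases hs
    have hmul := (hn'.mono hQ).of_isValue hP fun s hs => by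
      obtain ⟨i, -, rfl⟩ := Multiset.mem_map.1 hs
      exact hls i
    have hval : ∀ j ∈ sm.normal g, (ts j).IsValue ∧
        ∀ σ, ∃ i ∈ sm.normal f, ((ts j).subst σ).cdepth ≤ ((ls i).subst σ).cdepth := by
      intro j hj
      have h := hmul.1 (ts j) (Multiset.mem_map_of_mem ts hj)
      refine ⟨h.1, fun σ => ?_⟩
      obtain ⟨s, hs, hle⟩ := h.2 σ
      obtain ⟨i, hi, rfl⟩ := Multiset.mem_map.1 hs
      exact ⟨i, hi, hle⟩
    -- The normal arguments of the recursive call are instances of values by normal forms, hence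
    -- already normal: evaluation leaves them unchanged at cost 0, and the multiset decrease
    -- survives. The safe ones are below `f`, so none of them uses `E`.
    have key : ∀ j, ∃ q : ℕ[X], ∀ (σ : V → Term S V) (n d : ℕ),
        (∀ x ∈ (ts j).vars, IsNF R (σ x)) →
        (∀ i ∈ sm.normal f, ((ls i).subst σ).cdepth ≤ n) →
        (∀ i ∈ sm.safe f, ((ls i).subst σ).cdepth ≤ d) →
        Evals R ((ts j).subst σ) (q.eval n) fun u =>
          (j ∈ sm.normal g → u = (ts j).subst σ) ∧ (j ∈ sm.safe g → u.cdepth ≤ q.eval n + d) := by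
      intro j
      by_cases hj : j ∈ sm.safe g
      · obtain ⟨q, hq⟩ := (hs' j hj).exists_bound_of_below hR hP hf hp hls (hb j hj)
        exact ⟨q, fun σ n d hσ hn hd => (hq σ n d hσ hn hd).mono le_rfl fun u hu =>
          ⟨fun hj' => absurd hj (sm.notMem_safe hj'), fun _ => hu⟩⟩
      · have hj' := (sm.mem_normal_or_mem_safe j).resolve_right hj
        exact ⟨0, fun σ n d hσ hn hd => (hR.isNF_value (hval j hj').1 hσ).evals.mono
          (Nat.zero_le _) fun u hu => ⟨fun _ => hu, fun h => absurd h hj⟩⟩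
    choose q hq using key
    refine ⟨∑ j, q j, fun σ n d E hσ hn hd hE => ?_⟩
    have hle := fun j => eval_le_eval_sum q j n
    rw [Polynomial.eval_finsetSum] at hle ⊢
    refine Evals.app (fun j => hq j σ n d (fun x hx => hσ x (Set.mem_iUnion.2 ⟨j, hx⟩)) hn hd)
      fun w hw hΦ => ?_
    refine (hE g w (∑ j, (q j).eval n + d) hfg hw (fun j hj => ?_) ?_ fun j hj => ?_).mono le_rfl
      fun u hu => by omega
    · rw [(hΦ j).1 hj]
      obtain ⟨i, hi, hji⟩ := (hval j hj).2 σ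
      exact hji.trans (hn i hi)
    · have h := hmul.2 σ
      simp only [SafeMapping.normalArgs, Multiset.map_map] at h
      have hw' : normalDepths sm g w =
          (sm.normal g).val.map ((fun t => (t.subst σ).cdepth) ∘ ts) :=
        Multiset.map_congr rfl fun j hj => by rw [(hΦ j).1 hj]; rfl
      rw [hw']
      exact h
    · have := (hΦ j).2 hj
      have := hle j
      omega

/-! ## Chains of multisets -/

/-- The multisets over `{0, …, n}` with at most `A` elements. -/
def boundedMultisets (A n : ℕ) : Finset (Multiset ℕ) :=
  (Finset.range (A + 1)).biUnion fun k =>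
    (Fintype.piFinset fun _ : Fin k => Finset.range (n + 1)).image fun φ => Finset.univ.val.map φ

theorem mem_boundedMultisets {A n : ℕ} {M : Multiset ℕ} (hA : M.card ≤ A)
    (hn : ∀ x ∈ M, x ≤ n) : M ∈ boundedMultisets A n := by
  refine Finset.mem_biUnion.2 ⟨M.card, Finset.mem_range.2 (Nat.lt_succ_of_le hA), ?_⟩
  induction M using Quotient.inductionOn with
  | h l =>
    refine Finset.mem_image.2 ⟨l.get, Fintype.mem_piFinset.2 fun i => ?_, ?_⟩
    · exact Finset.mem_range.2 (Nat.lt_succ_of_le (hn _ (List.get_mem l i)))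
    · exact (Fin.univ_val_map l.get).trans (congrArg _ (List.ofFn_get l))

theorem card_boundedMultisets_le (A n : ℕ) :
    (boundedMultisets A n).card ≤ ∑ k ∈ Finset.range (A + 1), (n + 1) ^ k := by
  refine Finset.card_biUnion_le.trans (Finset.sum_le_sum fun k _ => ?_)
  refine Finset.card_image_le.trans ?_
  simp [Fintype.card_piFinset]

open Classical in
/-- The number of smaller multisets over `{0, …, n}` with at most `A` elements. -/
noncomputable def multisetRank (A n : ℕ) (M : Multiset ℕ) : ℕ :=
  ((boundedMultisets A n).filter fun N => Multiset.IsDershowitzMannaLT N M).card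

open Classical in
theorem multisetRank_le (A n : ℕ) (M : Multiset ℕ) :
    multisetRank A n M ≤ ∑ k ∈ Finset.range (A + 1), (n + 1) ^ k :=
  (Finset.card_filter_le _ _).trans (card_boundedMultisets_le A n)

open Classical in
-- By transitivity everything below `N` is below `M`; `N` itself is counted for `M` but, by
-- irreflexivity, not for `N`.
theorem multisetRank_lt {A n : ℕ} {M N : Multiset ℕ} (hN : N ∈ boundedMultisets A n)
    (h : Multiset.IsDershowitzMannaLT N M) : multisetRank A n N < multisetRank A n M := by
  refine Finset.card_lt_card (Finset.ssubset_iff_of_subset ?_ |>.2 ⟨N, ?_, ?_⟩)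
  · intro K hK
    rw [Finset.mem_filter] at hK ⊢
    exact ⟨hK.1, hK.2.trans h⟩
  · exact Finset.mem_filter.2 ⟨hN, h⟩
  · intro hN'
    exact (Multiset.wellFounded_isDershowitzMannaLT (α := ℕ)).irrefl.irrefl N
      (Finset.mem_filter.1 hN').2

/-! ## The bound on calls -/

/-- Recursion may pass between equivalent symbols, so one polynomial has to serve the whole
equivalence class of `f`. Summing over the finitely many rules provides it; rules for other symbols
contribute 0. -/
theorem exists_uniform_rule_bound (hR : IsConstructorTRS R) (hfin : R.Finite) (hP : P.Admissible)
    (hc : Compatible P sm R) {p : ℕ[X]} {f : S.Symb} (hp : ∀ g, P.gt f g → CallBound R sm g p) :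
    ∃ q : ℕ[X], ∀ (g : S.Symb) (ls : Fin (S.ar g) → Term S V) (r : Term S V), P.equiv f g →
      (Term.app g ls, r) ∈ R →
      ∀ (σ : V → Term S V) (n d E : ℕ), (∀ x ∈ r.vars, IsNF R (σ x)) →
      (∀ i ∈ sm.normal g, ((ls i).subst σ).cdepth ≤ n) →
      (∀ i ∈ sm.safe g, ((ls i).subst σ).cdepth ≤ d) →
      SmallerCallBound R P sm g n (normalDepths sm g fun i => (ls i).subst σ) E →
      Evals R (r.subst σ) (q.eval n + E) fun u => u.cdepth ≤ q.eval n + E + d := by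
  have key : ∀ ρ : R, ∃ q : ℕ[X], ∀ (g : S.Symb) (ls : Fin (S.ar g) → Term S V) (r : Term S V),
      P.equiv f g → (Term.app g ls, r) = ρ.1 →
      ∀ (σ : V → Term S V) (n d E : ℕ), (∀ x ∈ r.vars, IsNF R (σ x)) →
      (∀ i ∈ sm.normal g, ((ls i).subst σ).cdepth ≤ n) →
      (∀ i ∈ sm.safe g, ((ls i).subst σ).cdepth ≤ d) →
      SmallerCallBound R P sm g n (normalDepths sm g fun i => (ls i).subst σ) E →
      Evals R (r.subst σ) (q.eval n + E) fun u => u.cdepth ≤ q.eval n + E + d := by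
    rintro ⟨⟨l, r⟩, hlr⟩
    obtain ⟨g, ls, rfl, hg, hls⟩ := hR.exists_app hlr
    by_cases hfg : P.equiv f g
    · obtain ⟨q, hq⟩ := (hc _ _ hlr).exists_bound hR hP hg (fun k hk => hp k
        ⟨P.trans _ _ _ hfg.1 hk.1, fun h => hk.2 (P.trans _ _ _ h hfg.1)⟩) hls
      refine ⟨q, fun g' ls' r' _ h => ?_⟩
      cases h
      exact hq
    · refine ⟨0, fun g' ls' r' hfg' h => ?_⟩
      cases h
      exact absurd hfg' hfg
  have := hfin.fintype
  choose q hq using key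
  refine ⟨∑ ρ, q ρ, fun g ls r hfg hlr σ n d E hσ hn hd hE => ?_⟩
  have hle := eval_le_eval_sum q ⟨_, hlr⟩ n
  exact (hq ⟨_, hlr⟩ g ls r hfg rfl σ n d E hσ hn hd hE).mono (by omega) fun u hu => by omega

theorem exists_callBound_of_defined [Finite S.Symb] (hR : IsConstructorTRS R) (hfin : R.Finite)
    (hP : P.Admissible) (hc : Compatible P sm R) {p : ℕ[X]} {f : S.Symb} (hf : f ∈ S.Defined)
    (hp : ∀ g, P.gt f g → CallBound R sm g p) : ∃ q : ℕ[X], CallBound R sm f q := by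
  obtain ⟨q, hq⟩ := exists_uniform_rule_bound hR hfin hP hc hp
  have := Fintype.ofFinite S.Symb
  -- A common bound on the number of normal arguments of all symbols, as the arity may change along
  -- a chain of recursive calls.
  let A := ∑ g, S.ar g
  have hmem : ∀ {g : S.Symb} {w : Fin (S.ar g) → Term S V} {n : ℕ},
      (∀ i ∈ sm.normal g, (w i).cdepth ≤ n) → normalDepths sm g w ∈ boundedMultisets A n := by
    intro g w n hn
    refine mem_boundedMultisets ?_ fun x hx => ?_
    · rw [normalDepths, Multiset.card_map]
      refine (Finset.card_le_univ (sm.normal g)).trans ?_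
      rw [Fintype.card_fin]
      exact Finset.single_le_sum (f := fun g => S.ar g) (fun _ _ => Nat.zero_le _)
        (Finset.mem_univ g)
    · obtain ⟨i, hi, rfl⟩ := Multiset.mem_map.1 hx
      exact hn i hi
  have main : ∀ (m : ℕ) (g : S.Symb) (w : Fin (S.ar g) → Term S V) (n d : ℕ), P.equiv f g →
      (∀ i, IsNF R (w i)) → (∀ i ∈ sm.normal g, (w i).cdepth ≤ n) →
      (∀ i ∈ sm.safe g, (w i).cdepth ≤ d) → multisetRank A n (normalDepths sm g w) < m →
      Evals R (Term.app g w) (m * (q.eval n + 1)) fun t => t.cdepth ≤ m * (q.eval n + 1) + d := by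
    intro m
    induction m with
    | zero => exact fun g w n d _ _ _ _ h => absurd h (Nat.not_lt_zero _)
    | succ m ih =>
      intro g w n d hfg hw hn hd hm
      -- A recursive call has smaller rank for the same `n`, so the induction hypothesis supplies `E
      -- = m * (q(n) + 1)`. One rule application adds `q(n) + 1`, including the root step.
      have hE : SmallerCallBound R P sm g n (normalDepths sm g w) (m * (q.eval n + 1)) := by
        intro k v e hgk hv hvn hlt he
        exact ih k v n e ⟨P.trans _ _ _ hfg.1 hgk.1, P.trans _ _ _ hgk.2 hfg.2⟩ hv hvn he
          ((multisetRank_lt (hmem hvn) hlt).trans_le (Nat.le_of_lt_succ hm))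
      have hmul : (m + 1) * (q.eval n + 1) = q.eval n + m * (q.eval n + 1) + 1 := by ring
      rw [hmul]
      refine hR.evals_call hw ?_ fun ls r σ hlr _ hwls hσ => ?_
      · rw [Term.cdepth_defined ((hP f g hfg).1 hf)]
        omega
      · obtain rfl : w = fun i => (ls i).subst σ := funext hwls
        exact (hq g ls r hfg hlr σ n d _ hσ hn hd hE).mono le_rfl fun u hu => by omega
  -- The first factor is the bound on the rank plus one, because `main` needs the rank to be
  -- strictly below `m`.
  refine ⟨(∑ k ∈ Finset.range (A + 1), (X + 1) ^ k + 1) * (q + 1), fun w n d hw hn hd => ?_⟩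
  have heval : ((∑ k ∈ Finset.range (A + 1), (X + 1) ^ k + 1) * (q + 1) : ℕ[X]).eval n =
      (∑ k ∈ Finset.range (A + 1), (n + 1) ^ k + 1) * (q.eval n + 1) := by
    simp [Polynomial.eval_finsetSum]
  rw [heval]
  exact main _ f w n d ⟨P.refl f, P.refl f⟩ hw hn hd (Nat.lt_succ_of_le (multisetRank_le A n _))

theorem Precedence.wellFounded_gt [Finite S.Symb] (P : Precedence S) :
    WellFounded fun g f => P.gt f g := by
  have : IsTrans S.Symb fun g f => P.gt f g := ⟨fun a b c hab hbc =>
    ⟨P.trans _ _ _ hbc.1 hab.1, fun h => hab.2 (P.trans _ _ _ h hbc.1)⟩⟩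
  have : Std.Irrefl fun g f : S.Symb => P.gt f g := ⟨fun a h => h.2 h.1⟩
  exact Finite.wellFounded_of_trans_of_irrefl _

theorem exists_callBound [Finite S.Symb] (hR : IsConstructorTRS R) (hfin : R.Finite)
    (hP : P.Admissible) (hc : Compatible P sm R) (f : S.Symb) :
    ∃ p : ℕ[X], CallBound R sm f p := by
  induction f using P.wellFounded_gt.induction with
  | _ f ih =>
    by_cases hf : f ∈ S.Defined
    · have := Fintype.ofFinite S.Symb
      have key : ∀ g, ∃ p : ℕ[X], P.gt f g → CallBound R sm g p := fun g => by
        by_cases hfg : P.gt f g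
        · obtain ⟨p, hp⟩ := ih g hfg
          exact ⟨p, fun _ => hp⟩
        · exact ⟨0, fun h => absurd h hfg⟩
      choose p hp using key
      exact exists_callBound_of_defined hR hfin hP hc hf (p := ∑ g, p g) fun g hg =>
        (hp g hg).mono fun n => eval_le_eval_sum p g n
    · exact ⟨1, hR.callBound_constructor hf⟩

end Bounds

theorem CallBound.innermostHeight_le (hR : IsConstructorTRS R) {sm : SafeMapping S} {f : S.Symb}
    {p : ℕ[X]} (h : CallBound R sm f p) {us : Fin (S.ar f) → Term S V}
    (hus : ∀ i, (us i).IsValue) :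
    innermostHeight R (Term.app f us) ≤ ((p.eval (sm.normalDepth f us) : ℕ) : ℕ∞) := by
  have hnf : ∀ i, IsNF R (us i) := fun i => hR.isNF_of_isValue (hus i)
  -- Any bound on the safe depths will do, since the cost does not depend on it.
  have hb := h us (sm.normalDepth f us) (∑ i, (us i).cdepth) hnf
    (fun i hi => (hus i).cdepth_eq.trans_le
      (Finset.le_sup (f := fun i => (us i).depth) hi))
    (fun i _ => Finset.single_le_sum (f := fun i => (us i).cdepth) (fun _ _ => Nat.zero_le _)
      (Finset.mem_univ i))
  refine iSup₂_le fun n hn => ?_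
  obtain ⟨t, ht⟩ := hn
  exact Nat.cast_le.2 (hb n t ht).1

end Rewriting

/-! ### Uniformity in the precedence and the safe mapping -/

instance [Finite S.Symb] : Finite (Precedence S) :=
  Finite.of_injective Precedence.ge fun P Q h => by cases P; cases Q; cases h; rfl

instance [Finite S.Symb] : Finite (SafeMapping S) :=
  Finite.of_injective SafeMapping.safe fun P Q h => by cases P; cases Q; cases h; rfl

end POP

theorem mainTheorem5 {V : Type*} [Countable V] [Infinite V] (S : POP.Signature) [Finite S.Symb]
    (R : Set (POP.Term S V × POP.Term S V)) (hfin : R.Finite) (hR : POP.IsConstructorTRS R) :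
    ∃ p : Polynomial ℕ, ∀ (P : POP.Precedence S) (sm : POP.SafeMapping S),
      P.Admissible → POP.Compatible P sm R →
      ∀ (f : S.Symb) (us : Fin (S.ar f) → POP.Term S V), (POP.Term.app f us).IsBasic →
        POP.innermostHeight R (POP.Term.app f us) ≤ ((p.eval (sm.normalDepth f us) : ℕ) : ℕ∞) := by
  classical
  have := Fintype.ofFinite (POP.Precedence S)
  have := Fintype.ofFinite (POP.SafeMapping S)
  have := Fintype.ofFinite S.Symb
  -- Incompatible or inadmissible choices receive the polynomial 0; the sum over all finitely many
  -- choices and symbols dominates each bound.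
  have key : ∀ i : (POP.Precedence S × POP.SafeMapping S) × S.Symb, ∃ p : Polynomial ℕ,
      i.1.1.Admissible → POP.Compatible i.1.1 i.1.2 R → POP.CallBound R i.1.2 i.2 p := by
    rintro ⟨⟨P, sm⟩, f⟩
    by_cases h : P.Admissible ∧ POP.Compatible P sm R
    · obtain ⟨p, hp⟩ := POP.exists_callBound hR hfin h.1 h.2 f
      exact ⟨p, fun _ _ => hp⟩
    · exact ⟨0, fun h1 h2 => absurd ⟨h1, h2⟩ h⟩
  choose p hp using key
  refine ⟨∑ i, p i, fun P sm hP hc f us hus => ?_⟩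
  exact ((hp ((P, sm), f) hP hc).mono fun n =>
    POP.eval_le_eval_sum p ((P, sm), f) n).innermostHeight_le hR hus.2
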